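/- Let $q$ be a prime power, let $m,k,t\ge 1$ and $h\ge 0$ be integers with $h\le k-1$ and $(h+1)\mid mk$, and put $n=\frac{mk}{h+1}$ (so $n\ge m$). Let $\mathcal U=(\mathcal U_1,\ldots,\mathcal U_t)$ be an $h$-design $[(n,\ldots,n),k]_{q^m/q}$ system: the $\mathcal U_i$ are $\mathbb F_q$-subspaces of $\mathbb F_{q^m}^k$ with $\dim_{\mathbb F_q}\mathcal U_i=n$ for all $i$, they together span $\mathbb F_{q^m}^k$ over $\mathbb F_{q^m}$, and $\sum_{i=1}^t\dim_{\mathbb F_q}(\mathcal U_i\cap W)\le h$ for every $\mathbb F_{q^m}$-subspace $W$ of $\mathbb F_{q^m}^k$ of $\mathbb F_{q^m}$-dimension $h$. For integers $n',m',d,r$ let $$W_r(n',m',t)=\sum_{\mathbf W}\ \sum_{\ell=d}^{r}\bigl(q^{m'(\ell-d+1)}-1\bigr)\,f_\ell(\dim W_1,\ldots,\dim W_t),$$ where $\mathbf W=(W_1,\ldots,W_t)$ runs over all $t$-tuples of $\mathbb F_q$-subspaces of $\mathbb F_q^{n'}$ with $\sum_i\dim W_i=r$, and $$f_\ell(\mathbf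 u)=\sum_{\mathbf v\le\mathbf u,\ v_1+\cdots+v_t=\ell}\ \prod_{i=1}^t(-1)^{u_i-v_i}q^{\binom{u_i-v_i}{2}}\binom{u_i}{v_i}_q ,$$ the sum being over $\mathbf v\in\mathbb Z_{\ge0}^t$ with $v_i\le u_i$ for all $i$, and $\binom{a}{b}_q$ being the Gaussian binomial coefficient. (This is the number of codewords of sum-rank weight $r$ in a maximum sum-rank distance code of minimum distance $d$ in $\bigoplus_{i=1}^t\mathbb F_q^{m'\times n'}$, $m'\ge n'$.) Below, $d=tm-h$. Then for every $j\in\{0,\ldots,h\}$, the number of $\mathbb F_{q^m}$-hyperplanes $H$ of $\mathbb F_{q^m}^k$ such that $$\sum_{i=1}^t\dim_{\mathbb F_q}(\mathcal U_i\cap H)=t(n-m)+j$$ is equal to $$g_j=\frac{W_{tm-j}\left(m,\frac{mk}{h+1},t\right)}{q^m-1}.$$ Moreover, if $t\le q-1$, then $g_j>0$ for every $j\in\{0,\ldots,h\}$. -/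

import Mathlib

open Module

noncomputable section

/-- `U = (U_1, …, U_t)`, a tuple of `F`-subspaces of the `K`-vector space `V`, is a
(non-degenerate) `(h, r)`-subspace design: the `U_i` together span `V` over `K`, and
`∑ dim_F (U_i ∩ W) ≤ r` for every `K`-subspace `W` of `K`-dimension `h`. -/
def IsSubspaceDesign (F K : Type*) {V : Type*} [Field F] [Field K] [Algebra F K]
    [AddCommGroup V] [Module K V] [Module F V] [IsScalarTower F K V] {t : ℕ}
    (h r : ℕ) (U : Fin t → Submodule F V) : Prop :=
  Submodule.span K (⋃ i, (U i : Set V)) = ⊤ ∧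
    ∀ W : Submodule K V, finrank K W = h →
      ∑ i, finrank F ↥(U i ⊓ W.restrictScalars F) ≤ r

/-- An `h`-design is an `(h, h)`-subspace design. -/
def IsHDesign (F K : Type*) {V : Type*} [Field F] [Field K] [Algebra F K]
    [AddCommGroup V] [Module K V] [Module F V] [IsScalarTower F K V] {t : ℕ}
    (h : ℕ) (U : Fin t → Submodule F V) : Prop :=
  IsSubspaceDesign F K h h U

/-- The Gaussian binomial coefficient
`[a choose b]_q = ∏_{i < b} (q ^ (a - i) - 1) / (q ^ (i + 1) - 1)`
(used for `q ≥ 2`; it is `0` when `a < b`). -/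
def gaussBinom (q a b : ℕ) : ℚ :=
  ∏ i ∈ Finset.range b, ((q : ℚ) ^ (a - i) - 1) / ((q : ℚ) ^ (i + 1) - 1)

/-- `f_ℓ(u) = ∑_{v ≤ u, |v| = ℓ} ∏_i (-1)^(u_i - v_i) q^((u_i - v_i) choose 2) [u_i choose v_i]_q`. -/
def latticeCoeff (q : ℕ) {t : ℕ} (l : ℕ) (u : Fin t → ℕ) : ℚ :=
  ∑ v ∈ Finset.Iic u with ∑ i, v i = l,
    ∏ i, (-1 : ℚ) ^ (u i - v i) * (q : ℚ) ^ ((u i - v i).choose 2) * gaussBinom q (u i) (v i)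

/-- The number `W_r(n', m', t)`, for the minimum distance `d` and `q = |F|`:
the sum over all `t`-tuples `W` of `F`-subspaces of `F ^ n'` with `∑ dim W_i = r` of
`∑_{ℓ = d}^{r} (q ^ (m' (ℓ - d + 1)) - 1) f_ℓ(dim W_1, …, dim W_t)`.
(There are finitely many such tuples when `F` is finite.) -/
def msrdWeight (F : Type*) [Field F] (n' m' t d r : ℕ) : ℚ :=
  ∑ᶠ W ∈ {W : Fin t → Submodule F (Fin n' → F) | ∑ i, finrank F (W i) = r},
    ∑ l ∈ Finset.Icc d r,
      ((Nat.card F : ℚ) ^ (m' * (l - d + 1)) - 1) *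
        latticeCoeff (Nat.card F) l (fun i => finrank F (W i))

end

/-! Let V = K^k and d = tm - h. Hyperplanes are kernels of nonzero functionals φ, each arising from
q^m - 1 of them, and rank-nullity on each `U i` turns the intersection condition into ∑ dim φ(U i) =
tm - j. So functionals of given sum-rank weight are counted.

For a tuple B of F-subspaces of K let C i be the trace-orthogonal of B i. Then φ(U i) ≤ B i for all
i iff Tr ∘ φ kills ∑ C i · U i, and φ ↦ Tr ∘ φ is a bijection onto the F-dual of V. The design
property makes the map ⨁ C i ⊗ U i → V injective when ∑ dim C i ≤ h + 1
(`IsHDesign.eq_zero_of_sum_smul_eq_zero`), so the number of such φ depends only on ∑ dim B i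
(`IsHDesign.natCard_map_le_eq_pow`). Möbius inversion over tuples of subspaces counts the φ with φ(U
i) = B i exactly (`IsHDesign.natCard_map_eq`), and summing over B gives `msrdWeight`.

Positivity does not use the signed formula: for t ≤ q - 1 a union bound shows that every B of total
dimension at least d is attained (`IsHDesign.exists_map_eq`). -/

section GaussBinom

/-! ### Gaussian binomials and their alternating sums. -/

variable {q : ℕ}

lemma gaussBinom_zero_right (q u : ℕ) : gaussBinom q u 0 = 1 := by simp [gaussBinom]

lemma gaussBinom_eq_zero_of_lt {u v : ℕ} (h : u < v) : gaussBinom q u v = 0 :=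
  Finset.prod_eq_zero (Finset.mem_range.2 h) (by simp)

lemma cast_pow_succ_sub_one_ne_zero (hq : 1 < q) (i : ℕ) : (q : ℚ) ^ (i + 1) - 1 ≠ 0 := by
  have : (1 : ℚ) < (q : ℚ) ^ (i + 1) := one_lt_pow₀ (by exact_mod_cast hq) (by omega)
  linarith

lemma gaussBinom_succ_right (u v : ℕ) :
    gaussBinom q u (v + 1) =
      gaussBinom q u v * (((q : ℚ) ^ (u - v) - 1) / ((q : ℚ) ^ (v + 1) - 1)) := by
  simp [gaussBinom, Finset.prod_range_succ, mul_div_mul_comm]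

lemma gaussBinom_succ_left (u v : ℕ) :
    gaussBinom q (u + 1) (v + 1) =
      gaussBinom q u v * (((q : ℚ) ^ (u + 1) - 1) / ((q : ℚ) ^ (v + 1) - 1)) := by
  simp only [gaussBinom, Finset.prod_div_distrib]
  rw [Finset.prod_range_succ', Finset.prod_range_succ (fun i => (q : ℚ) ^ (i + 1) - 1)]
  simp only [Nat.add_sub_add_right, Nat.sub_zero]
  rw [mul_div_mul_comm]

lemma gaussBinom_succ_succ (hq : 1 < q) (u v : ℕ) :
    gaussBinom q (u + 1) (v + 1) =
      gaussBinom q u v + (q : ℚ) ^ (v + 1) * gaussBinom q u (v + 1) := by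
  rcases lt_or_ge u v with h | h
  · rw [gaussBinom_eq_zero_of_lt h, gaussBinom_eq_zero_of_lt (by omega : u < v + 1),
      gaussBinom_eq_zero_of_lt (by omega : u + 1 < v + 1)]
    simp
  · have h1 := cast_pow_succ_sub_one_ne_zero hq v
    have h2 : (q : ℚ) ^ (u + 1) = (q : ℚ) ^ (v + 1) * (q : ℚ) ^ (u - v) := by
      rw [← pow_add]; congr 1; omega
    rw [gaussBinom_succ_left, gaussBinom_succ_right, h2]
    field_simp
    ring

/-- The coefficient of `x ^ v` in `∏_{i < u} (x - q ^ i)`. -/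
noncomputable def moebiusCoeff (q u v : ℕ) : ℚ :=
  (-1 : ℚ) ^ (u - v) * (q : ℚ) ^ ((u - v).choose 2)

/-- This is the q-binomial theorem for ∏ (x - q^i) at x = 1; the new factor is 1 - q^u, which
vanishes for u = 0. The proof is the q-Pascal rule term by term. -/
lemma sum_moebiusCoeff_mul_gaussBinom_succ (hq : 1 < q) (u : ℕ) :
    ∑ v ∈ Finset.range (u + 1 + 1), moebiusCoeff q (u + 1) v * gaussBinom q (u + 1) v =
      (1 - (q : ℚ) ^ u) *
        ∑ v ∈ Finset.range (u + 1), moebiusCoeff q u v * gaussBinom q u v := by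
  have hstep : ∀ v ∈ Finset.range (u + 1),
      moebiusCoeff q (u + 1) (v + 1) * gaussBinom q (u + 1) (v + 1) =
        moebiusCoeff q u v * gaussBinom q u v -
          (q : ℚ) ^ u * (moebiusCoeff q u (v + 1) * gaussBinom q u (v + 1)) := by
    intro v hv
    rw [Finset.mem_range] at hv
    rw [gaussBinom_succ_succ hq]
    -- At v = u the truncated exponent u - (v + 1) is meaningless, but its term carries a vanishing
    -- Gaussian binomial.
    rcases Nat.eq_or_lt_of_le (Nat.le_of_lt_succ hv) with h | h
    · subst h
      rw [gaussBinom_eq_zero_of_lt (Nat.lt_succ_self v)]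
      simp [moebiusCoeff]
    · obtain ⟨w, rfl⟩ : ∃ w, u = v + 1 + w := ⟨u - v - 1, by omega⟩
      simp only [moebiusCoeff, show v + 1 + w + 1 - (v + 1) = w + 1 by omega,
        show v + 1 + w - v = w + 1 by omega, show v + 1 + w - (v + 1) = w by omega]
      rw [Nat.choose_succ_succ' w 1, Nat.choose_one_right]
      ring
  rw [Finset.sum_range_succ', Finset.sum_congr rfl hstep, Finset.sum_sub_distrib,
    ← Finset.mul_sum,
    Finset.sum_range_succ (fun v => moebiusCoeff q u (v + 1) * gaussBinom q u (v + 1)),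
    gaussBinom_eq_zero_of_lt (Nat.lt_succ_self u), gaussBinom_zero_right]
  have h0 : moebiusCoeff q (u + 1) 0 =
      -((q : ℚ) ^ u * (moebiusCoeff q u 0 * gaussBinom q u 0)) := by
    simp only [moebiusCoeff, Nat.sub_zero, gaussBinom_zero_right]
    rw [Nat.choose_succ_succ' u 1, Nat.choose_one_right]
    ring
  rw [h0]
  have := Finset.sum_range_succ' (fun v => moebiusCoeff q u v * gaussBinom q u v) u
  rw [this]
  ring

lemma sum_moebiusCoeff_mul_gaussBinom (hq : 1 < q) {u : ℕ} (hu : u ≠ 0) :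
    ∑ v ∈ Finset.range (u + 1), moebiusCoeff q u v * gaussBinom q u v = 0 := by
  obtain ⟨u, rfl⟩ := Nat.exists_eq_succ_of_ne_zero hu
  induction u with
  | zero => simp [sum_moebiusCoeff_mul_gaussBinom_succ hq]
  | succ u ih => rw [Nat.succ_eq_add_one, sum_moebiusCoeff_mul_gaussBinom_succ hq,
      ih (by omega), mul_zero]

/-- The two products count independent v-tuples in dimensions v and u; this is the shape needed for
double counting. -/
lemma gaussBinom_eq_prod_div (hq : 1 < q) {u v : ℕ} (h : v ≤ u) :
    gaussBinom q u v * ∏ i : Fin v, ((q : ℚ) ^ v - (q : ℚ) ^ (i : ℕ)) =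
      ∏ i : Fin v, ((q : ℚ) ^ u - (q : ℚ) ^ (i : ℕ)) := by
  rw [Fin.prod_univ_eq_prod_range (fun i => (q : ℚ) ^ v - (q : ℚ) ^ i),
    Fin.prod_univ_eq_prod_range (fun i => (q : ℚ) ^ u - (q : ℚ) ^ i)]
  have key : ∀ w, v ≤ w → ∏ i ∈ Finset.range v, ((q : ℚ) ^ w - (q : ℚ) ^ i) =
      (∏ i ∈ Finset.range v, (q : ℚ) ^ i) * ∏ i ∈ Finset.range v, ((q : ℚ) ^ (w - i) - 1) := by
    intro w hw
    rw [← Finset.prod_mul_distrib]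
    refine Finset.prod_congr rfl fun i hi => ?_
    have : i ≤ w := by rw [Finset.mem_range] at hi; omega
    rw [mul_sub, ← pow_add, Nat.add_sub_cancel' this, mul_one]
  rw [key u h, key v le_rfl, gaussBinom, Finset.prod_div_distrib,
    ← Finset.prod_range_reflect (fun i => (q : ℚ) ^ (i + 1) - 1)]
  have h1 : ∏ i ∈ Finset.range v, ((q : ℚ) ^ (v - 1 - i + 1) - 1) =
      ∏ i ∈ Finset.range v, ((q : ℚ) ^ (v - i) - 1) := by
    refine Finset.prod_congr rfl fun i hi => ?_
    rw [Finset.mem_range] at hi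
    rw [show v - 1 - i + 1 = v - i by omega]
  have h2 : ∏ i ∈ Finset.range v, ((q : ℚ) ^ (v - i) - 1) ≠ 0 := by
    refine Finset.prod_ne_zero_iff.2 fun i hi => ?_
    rw [Finset.mem_range] at hi
    rw [show v - i = (v - i - 1) + 1 by omega]
    exact cast_pow_succ_sub_one_ne_zero hq _
  rw [h1]
  field_simp

end GaussBinom

/-! ### Counting subspaces of given dimension. -/

section CountSubspaces

variable {F V : Type*} [Field F] [Finite F] [AddCommGroup V] [Module F V] [Finite V]

lemma natCard_linearIndependent (v : ℕ) (h : v ≤ finrank F V) :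
    (Nat.card {s : Fin v → V // LinearIndependent F s} : ℚ) =
      ∏ i : Fin v, ((Nat.card F : ℚ) ^ finrank F V - (Nat.card F : ℚ) ^ (i : ℕ)) := by
  have := Fintype.ofFinite F
  have : Module.Finite F V := Module.Finite.of_finite
  rw [card_linearIndependent h, Nat.card_eq_fintype_card, Nat.cast_prod]
  refine Finset.prod_congr rfl fun i _ => ?_
  rw [Nat.cast_sub (Nat.pow_le_pow_right Fintype.card_pos (by omega))]
  push_cast
  rfl

/-- Linearly independent `v`-tuples of vectors are ordered bases of the `v`-dimensional
subspaces. -/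
noncomputable def linearIndependentEquivSigma (F V : Type*) [Field F] [AddCommGroup V]
    [Module F V] [Module.Finite F V] (v : ℕ) :
    {s : Fin v → V // LinearIndependent F s} ≃
      Σ W : {W : Submodule F V // finrank F W = v},
        {s : Fin v → W.1 // LinearIndependent F s} where
  toFun s := ⟨⟨Submodule.span F (Set.range s.1), by
      rw [finrank_span_eq_card s.2, Fintype.card_fin]⟩,
    ⟨fun i => ⟨s.1 i, Submodule.subset_span ⟨i, rfl⟩⟩, linearIndependent_span s.2⟩⟩
  invFun p := ⟨fun i => (p.2.1 i : V),
    p.2.2.map' p.1.1.subtype (Submodule.ker_subtype _)⟩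
  left_inv s := rfl
  right_inv := by
    rintro ⟨⟨W, hW⟩, ⟨s, hs⟩⟩
    have hspan : Submodule.span F (Set.range fun i => (s i : V)) = W := by
      apply Submodule.eq_of_le_of_finrank_eq
      · rw [Submodule.span_le]
        rintro _ ⟨i, rfl⟩
        exact (s i).2
      · have := finrank_span_eq_card (hs.map' W.subtype (Submodule.ker_subtype _))
        rw [Fintype.card_fin] at this
        rw [hW]
        exact this
    -- Ambient vectors `s'` do not depend on `W`, so `hspan` can then be substituted for `W`.
    obtain ⟨s', hs', rfl⟩ : ∃ (s' : Fin v → V) (h : ∀ i, s' i ∈ W), s = fun i => ⟨s' i, h i⟩ :=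
      ⟨fun i => s i, fun i => (s i).2, rfl⟩
    replace hspan : Submodule.span F (Set.range s') = W := hspan
    subst hspan
    rfl

theorem natCard_submodule_finrank_eq (v : ℕ) :
    (Nat.card {W : Submodule F V // finrank F W = v} : ℚ) =
      gaussBinom (Nat.card F) (finrank F V) v := by
  have : Module.Finite F V := Module.Finite.of_finite
  have hq : 1 < Nat.card F := Finite.one_lt_card
  rcases lt_or_ge (finrank F V) v with h | h
  · rw [gaussBinom_eq_zero_of_lt h]
    have : IsEmpty {W : Submodule F V // finrank F W = v} :=
      ⟨fun W => by have := Submodule.finrank_le W.1; have := W.2; omega⟩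
    simp
  · have h1 := natCard_linearIndependent (F := F) (V := V) v h
    have := Fintype.ofFinite {W : Submodule F V // finrank F W = v}
    rw [Nat.card_congr (linearIndependentEquivSigma F V v), Nat.card_sigma, Nat.cast_sum,
      ← gaussBinom_eq_prod_div hq h] at h1
    have h2 : ∀ W : {W : Submodule F V // finrank F W = v},
        (Nat.card {s : Fin v → W.1 // LinearIndependent F s} : ℚ) =
          ∏ i : Fin v, ((Nat.card F : ℚ) ^ v - (Nat.card F : ℚ) ^ (i : ℕ)) := by
      intro W
      have := natCard_linearIndependent (F := F) (V := W.1) v W.2.ge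
      rwa [W.2] at this
    simp only [h2, Finset.sum_const, Finset.card_univ, nsmul_eq_mul] at h1
    have h3 : ∏ i : Fin v, ((Nat.card F : ℚ) ^ v - (Nat.card F : ℚ) ^ (i : ℕ)) ≠ 0 := by
      refine Finset.prod_ne_zero_iff.2 fun i _ => ?_
      have : (Nat.card F : ℚ) ^ (i : ℕ) < (Nat.card F : ℚ) ^ v :=
        pow_lt_pow_right₀ (by exact_mod_cast hq) i.2
      linarith
    rw [Nat.card_eq_fintype_card]
    exact mul_right_cancel₀ h3 h1

end CountSubspaces

/-! ### Möbius inversion over tuples of subspaces. -/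

section Moebius

variable {F V : Type*} [Field F] [AddCommGroup V] [Module F V]

lemma finrank_comap_mkQ [Module.Finite F V] (D : Submodule F V) (S : Submodule F (V ⧸ D)) :
    finrank F (S.comap D.mkQ) = finrank F S + finrank F D := by
  have h := LinearMap.finrank_range_add_finrank_ker (D.mkQ.domRestrict (S.comap D.mkQ))
  have h1 : LinearMap.range (D.mkQ.domRestrict (S.comap D.mkQ)) = S := by
    rw [LinearMap.range_domRestrict, Submodule.map_comap_eq_of_surjective D.mkQ_surjective]
  have hle : D ≤ S.comap D.mkQ := fun x hx => by
    rw [Submodule.mem_comap, Submodule.mkQ_apply, (Submodule.Quotient.mk_eq_zero D).2 hx]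
    exact S.zero_mem
  have h2 : LinearMap.ker (D.mkQ.domRestrict (S.comap D.mkQ)) =
      D.comap (S.comap D.mkQ).subtype := by
    ext x
    simp
  rw [h1, h2, (Submodule.comapSubtypeEquivOfLe hle).finrank_eq] at h
  exact h.symm

/-- Subspaces between `D` and `B` correspond to subspaces of `B ⧸ D`. -/
noncomputable def submoduleQuotientEquivInterval {D B : Submodule F V} (h : D ≤ B) :
    Submodule F (B ⧸ D.comap B.subtype) ≃ {C : Submodule F V // D ≤ C ∧ C ≤ B} where
  toFun S := ⟨(S.comap (D.comap B.subtype).mkQ).map B.subtype, by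
      intro x hx
      refine ⟨⟨x, h hx⟩, ?_, rfl⟩
      have : (⟨x, h hx⟩ : B) ∈ D.comap B.subtype := hx
      rw [SetLike.mem_coe, Submodule.mem_comap, Submodule.mkQ_apply,
        (Submodule.Quotient.mk_eq_zero _).2 this]
      exact S.zero_mem, Submodule.map_subtype_le _ _⟩
  invFun C := (C.1.comap B.subtype).map (D.comap B.subtype).mkQ
  left_inv S := by
    dsimp only
    rw [Submodule.comap_map_eq_of_injective B.subtype_injective,
      Submodule.map_comap_eq_of_surjective (Submodule.mkQ_surjective _)]
  right_inv C := by
    refine Subtype.ext ?_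
    dsimp only
    rw [Submodule.comap_map_mkQ, sup_eq_right.2 (Submodule.comap_mono C.2.1),
      Submodule.map_comap_subtype, inf_eq_right.2 C.2.2]

lemma finrank_submoduleQuotientEquivInterval [Module.Finite F V] {D B : Submodule F V} (h : D ≤ B)
    (S : Submodule F (B ⧸ D.comap B.subtype)) :
    finrank F (submoduleQuotientEquivInterval h S).1 = finrank F D + finrank F S := by
  change finrank F ((S.comap (D.comap B.subtype).mkQ).map B.subtype) = _
  rw [Submodule.finrank_map_subtype_eq, finrank_comap_mkQ,
    (Submodule.comapSubtypeEquivOfLe h).finrank_eq, add_comm]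

lemma finrank_quotient_comap_subtype [Module.Finite F V] {D B : Submodule F V} (h : D ≤ B) :
    finrank F (B ⧸ D.comap B.subtype) = finrank F B - finrank F D := by
  rw [Submodule.finrank_quotient, (Submodule.comapSubtypeEquivOfLe h).finrank_eq]

variable [Finite F]

lemma sum_finrank_eq_sum_gaussBinom [Finite V] [Fintype (Submodule F V)] (f : ℕ → ℚ) :
    ∑ W : Submodule F V, f (finrank F W) =
      ∑ v ∈ Finset.range (finrank F V + 1), gaussBinom (Nat.card F) (finrank F V) v * f v := by
  classical
  have : Module.Finite F V := Module.Finite.of_finite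
  rw [← Finset.sum_fiberwise_of_maps_to (s := Finset.univ)
    (t := Finset.range (finrank F V + 1)) (g := fun W : Submodule F V => finrank F W)
    (fun W _ => Finset.mem_range.2 (Nat.lt_succ_of_le W.finrank_le))]
  refine Finset.sum_congr rfl fun v _ => ?_
  rw [← natCard_submodule_finrank_eq, Nat.card_eq_fintype_card, Fintype.card_subtype,
    Finset.sum_congr rfl (g := fun _ => f v), Finset.sum_const, nsmul_eq_mul]
  intro W hW
  rw [(Finset.mem_filter.1 hW).2]

open Classical in
lemma sum_interval_eq_sum_gaussBinom [Finite V] [Fintype (Submodule F V)] {D B : Submodule F V}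
    (h : D ≤ B) (f : ℕ → ℚ) :
    ∑ C : Submodule F V with D ≤ C ∧ C ≤ B, f (finrank F C) =
      ∑ v ∈ Finset.range (finrank F B - finrank F D + 1),
        gaussBinom (Nat.card F) (finrank F B - finrank F D) v * f (finrank F D + v) := by
  have : Module.Finite F V := Module.Finite.of_finite
  have : Finite (B ⧸ D.comap B.subtype) := Finite.of_surjective _ (Submodule.mkQ_surjective _)
  have := Fintype.ofFinite (Submodule F (B ⧸ D.comap B.subtype))
  rw [← Finset.sum_subtype_eq_sum_filter, Finset.subtype_univ,
    ← (submoduleQuotientEquivInterval h).sum_comp]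
  simp only [finrank_submoduleQuotientEquivInterval]
  rw [sum_finrank_eq_sum_gaussBinom (fun v => f (finrank F D + v)),
    finrank_quotient_comap_subtype h]

open Classical in
/-- The Möbius function of the lattice of subspaces. -/
lemma sum_moebiusCoeff_interval [Finite V] [Fintype (Submodule F V)] (D B : Submodule F V) :
    ∑ C : Submodule F V with D ≤ C ∧ C ≤ B,
      moebiusCoeff (Nat.card F) (finrank F B) (finrank F C) = if D = B then 1 else 0 := by
  have : Module.Finite F V := Module.Finite.of_finite
  by_cases h : D ≤ B
  · rw [sum_interval_eq_sum_gaussBinom h]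
    have hle := Submodule.finrank_mono h
    have hc : ∀ v ∈ Finset.range (finrank F B - finrank F D + 1),
        gaussBinom (Nat.card F) (finrank F B - finrank F D) v *
          moebiusCoeff (Nat.card F) (finrank F B) (finrank F D + v) =
        moebiusCoeff (Nat.card F) (finrank F B - finrank F D) v *
          gaussBinom (Nat.card F) (finrank F B - finrank F D) v := by
      intro v _
      rw [mul_comm, moebiusCoeff, moebiusCoeff, Nat.sub_add_eq]
    rw [Finset.sum_congr rfl hc]
    split_ifs with hDB
    · subst hDB
      simp [moebiusCoeff, gaussBinom]
    · refine sum_moebiusCoeff_mul_gaussBinom Finite.one_lt_card ?_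
      have := Submodule.finrank_lt_finrank_of_lt (lt_of_le_of_ne h hDB)
      omega
  · rw [if_neg (fun e => h e.le)]
    refine Finset.sum_eq_zero fun C hC => ?_
    obtain ⟨_, h1, h2⟩ := Finset.mem_filter.1 hC
    exact absurd (h1.trans h2) h

variable {t : ℕ}

-- After exchanging the sums, the coefficient of `M D` factors over i into interval sums, each 1 or
-- 0 according to whether D i = B i.
open Classical in
lemma moebius_inversion_tuple [Finite V] [Fintype (Submodule F V)]
    (M : (Fin t → Submodule F V) → ℚ) (B : Fin t → Submodule F V) :
    ∑ C : Fin t → Submodule F V with C ≤ B,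
      (∏ i, moebiusCoeff (Nat.card F) (finrank F (B i)) (finrank F (C i))) *
        ∑ D : Fin t → Submodule F V with D ≤ C, M D = M B := by
  simp_rw [Finset.mul_sum]
  rw [Finset.sum_comm' (t' := Finset.univ)
    (s' := fun D => Fintype.piFinset fun i =>
      Finset.univ.filter fun C : Submodule F V => D i ≤ C ∧ C ≤ B i)
    (fun C D => by simp [Pi.le_def, forall_and, and_comm])]
  simp_rw [← Finset.sum_mul]
  have key : ∀ D : Fin t → Submodule F V,
      ∑ C ∈ Fintype.piFinset fun i =>
          Finset.univ.filter fun C : Submodule F V => D i ≤ C ∧ C ≤ B i,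
        ∏ i, moebiusCoeff (Nat.card F) (finrank F (B i)) (finrank F (C i)) =
      if D = B then 1 else 0 := by
    intro D
    rw [← Finset.prod_univ_sum (fun i =>
      Finset.univ.filter fun C : Submodule F V => D i ≤ C ∧ C ≤ B i)
      (fun i C => moebiusCoeff (Nat.card F) (finrank F (B i)) (finrank F C))]
    simp_rw [sum_moebiusCoeff_interval, Finset.prod_ite_zero, Finset.prod_const_one,
      Finset.mem_univ, true_imp_iff, funext_iff]
  simp [key]

open Classical in
lemma sum_finrank_tuple_eq [Finite V] [Fintype (Submodule F V)] (g : (Fin t → ℕ) → ℚ)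
    (B : Fin t → Submodule F V) :
    ∑ C : Fin t → Submodule F V with C ≤ B, g (fun i => finrank F (C i)) =
      ∑ v ∈ Finset.Iic (fun i => finrank F (B i)),
        (∏ i, gaussBinom (Nat.card F) (finrank F (B i)) (v i)) * g v := by
  have : Module.Finite F V := Module.Finite.of_finite
  have hmaps : ∀ C ∈ Finset.univ.filter fun C : Fin t → Submodule F V => C ≤ B,
      (fun i => finrank F (C i)) ∈ Finset.Iic (fun i => finrank F (B i)) := fun C hC =>
    Finset.mem_Iic.2 fun i => Submodule.finrank_mono ((Finset.mem_filter.1 hC).2 i)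
  rw [← Finset.sum_fiberwise_of_maps_to hmaps]
  refine Finset.sum_congr rfl fun v hv => ?_
  rw [Finset.sum_congr rfl (g := fun _ => g v)
    (fun C hC => by rw [(Finset.mem_filter.1 hC).2]), Finset.sum_const, nsmul_eq_mul]
  congr 1
  have hset : ((Finset.univ.filter fun C : Fin t → Submodule F V => C ≤ B).filter
      fun C => (fun i => finrank F (C i)) = v) =
      Fintype.piFinset fun i => (Finset.univ.filter fun C : Submodule F V =>
        ⊥ ≤ C ∧ C ≤ B i).filter fun C : Submodule F V => finrank F C = v i := by
    ext C
    simp [Pi.le_def, funext_iff, forall_and]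
  rw [hset, Fintype.card_piFinset, Nat.cast_prod]
  refine Finset.prod_congr rfl fun i _ => ?_
  rw [Finset.card_filter, Nat.cast_sum]
  have := sum_interval_eq_sum_gaussBinom (F := F) (bot_le : ⊥ ≤ B i)
    (fun w => ((if w = v i then 1 else 0 : ℕ) : ℚ))
  rw [this]
  have hvi : v i ≤ finrank F (B i) := Finset.mem_Iic.1 hv i
  simp
  omega

-- Grouping tuples by dimension vector, then by total dimension, is what produces `latticeCoeff`
-- from Möbius inversion.
open Classical in
lemma sum_moebiusCoeff_mul_eq_sum_latticeCoeff [Finite V] [Fintype (Submodule F V)] (g : ℕ → ℚ)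
    (B : Fin t → Submodule F V) :
    ∑ C : Fin t → Submodule F V with C ≤ B,
      (∏ i, moebiusCoeff (Nat.card F) (finrank F (B i)) (finrank F (C i))) *
        g (∑ i, finrank F (C i)) =
    ∑ l ∈ Finset.range (∑ i, finrank F (B i) + 1),
      g l * latticeCoeff (Nat.card F) l (fun i => finrank F (B i)) := by
  rw [sum_finrank_tuple_eq (fun v => (∏ i, moebiusCoeff (Nat.card F) (finrank F (B i)) (v i)) *
    g (∑ i, v i)) B]
  rw [← Finset.sum_fiberwise_of_maps_to (g := fun v : Fin t → ℕ => ∑ i, v i)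
    (t := Finset.range (∑ i, finrank F (B i) + 1))
    (fun v hv => Finset.mem_range.2 (Nat.lt_succ_of_le
      (Finset.sum_le_sum fun i _ => Finset.mem_Iic.1 hv i)))]
  refine Finset.sum_congr rfl fun l _ => ?_
  rw [latticeCoeff, Finset.mul_sum]
  refine Finset.sum_congr rfl fun v hv => ?_
  rw [(Finset.mem_filter.1 hv).2, Finset.prod_mul_distrib]
  simp only [moebiusCoeff]
  ring

/-- The full sum factors over i, and a factor with u i ≠ 0 vanishes. It accounts for the "- 1" in
`msrdWeight`. -/
lemma sum_latticeCoeff_eq_zero {q : ℕ} (hq : 1 < q) {u : Fin t → ℕ} (hu : ∑ i, u i ≠ 0) :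
    ∑ l ∈ Finset.range (∑ i, u i + 1), latticeCoeff q l u = 0 := by
  simp only [latticeCoeff]
  rw [Finset.sum_fiberwise_of_maps_to (g := fun v : Fin t → ℕ => ∑ i, v i)
    (fun v hv => Finset.mem_range.2 (Nat.lt_succ_of_le
      (Finset.sum_le_sum fun i _ => Finset.mem_Iic.1 hv i)))]
  have hIic : Finset.Iic u = Fintype.piFinset fun i => Finset.range (u i + 1) := by
    ext v
    simp [Pi.le_def]
  obtain ⟨i, -, hi⟩ := Finset.exists_ne_zero_of_sum_ne_zero hu
  rw [hIic, ← Finset.prod_univ_sum (fun i => Finset.range (u i + 1))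
    (fun i w => (-1 : ℚ) ^ (u i - w) * (q : ℚ) ^ ((u i - w).choose 2) * gaussBinom q (u i) w)]
  exact Finset.prod_eq_zero (Finset.mem_univ i) (sum_moebiusCoeff_mul_gaussBinom hq hi)

end Moebius

/-! ### Hyperplanes and nonzero functionals. -/

section Hyperplanes

variable {K V : Type*} [Field K] [AddCommGroup V] [Module K V]

lemma eq_ker_of_mem_dualAnnihilator [Module.Finite K V] {H : Submodule K V}
    (hH : finrank K H + 1 = finrank K V) {φ : Dual K V} (hφ : φ ≠ 0)
    (h : φ ∈ H.dualAnnihilator) : LinearMap.ker φ = H := by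
  have h1 := Dual.finrank_ker_add_one_of_ne_zero hφ
  refine (Submodule.eq_of_le_of_finrank_eq (fun x hx => ?_) (by omega)).symm
  exact (Submodule.mem_dualAnnihilator φ).1 h x hx

/-- Nonzero functionals are pairs of a hyperplane and a nonzero functional vanishing on it. -/
def nonzeroDualEquivSigma [Module.Finite K V] (P : Submodule K V → Prop) :
    {φ : Dual K V // φ ≠ 0 ∧ P (LinearMap.ker φ)} ≃
      Σ H : {H : Submodule K V // finrank K H + 1 = finrank K V ∧ P H},
        {φ : H.1.dualAnnihilator // φ ≠ 0} where
  toFun φ := ⟨⟨LinearMap.ker φ.1, Dual.finrank_ker_add_one_of_ne_zero φ.2.1, φ.2.2⟩,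
    ⟨⟨φ.1, (Submodule.mem_dualAnnihilator _).2 fun _ hx => hx⟩,
      fun h => φ.2.1 (congrArg Subtype.val h)⟩⟩
  invFun p := ⟨p.2.1.1, fun h => p.2.2 (Subtype.ext h), by
    rw [eq_ker_of_mem_dualAnnihilator p.1.2.1 (fun h => p.2.2 (Subtype.ext h)) p.2.1.2]
    exact p.1.2.2⟩
  left_inv _ := rfl
  right_inv := by
    rintro ⟨⟨H, hH, hP⟩, ⟨⟨φ, hφ⟩, h0⟩⟩
    have : LinearMap.ker φ = H :=
      eq_ker_of_mem_dualAnnihilator hH (fun h => h0 (Subtype.ext h)) hφ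
    subst this
    rfl

theorem natCard_nonzero_dual_eq [Finite K] [Module.Finite K V] (P : Submodule K V → Prop) :
    Nat.card {φ : Dual K V // φ ≠ 0 ∧ P (LinearMap.ker φ)} =
      Nat.card {H : Submodule K V // finrank K H + 1 = finrank K V ∧ P H} *
        (Nat.card K - 1) := by
  have : Finite V := Module.finite_of_finite K
  have := Fintype.ofFinite {H : Submodule K V // finrank K H + 1 = finrank K V ∧ P H}
  have : Finite (Dual K V) := Module.finite_of_finite K
  rw [Nat.card_congr (nonzeroDualEquivSigma P), Nat.card_sigma,
    Finset.sum_congr rfl (g := fun _ => Nat.card K - 1), Finset.sum_const, smul_eq_mul,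
    Finset.card_univ, ← Nat.card_eq_fintype_card]
  intro H _
  have h1 := Subspace.finrank_add_finrank_dualAnnihilator_eq H.1
  have h2 : finrank K H.1.dualAnnihilator = 1 := by have := H.2.1; omega
  have h3 : Nat.card H.1.dualAnnihilator = Nat.card K := by
    rw [Module.natCard_eq_pow_finrank (K := K), h2, pow_one]
  classical
  have := Fintype.ofFinite H.1.dualAnnihilator
  rw [Nat.card_eq_fintype_card, ← h3, Nat.card_eq_fintype_card]
  exact Set.card_ne_eq 0

end Hyperplanes

/-! ### Linear independence from the design property. -/

section Independence

variable {F K V : Type*} [Field F] [Field K] [Algebra F K] [AddCommGroup V] [Module K V]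
  [Module F V] [IsScalarTower F K V] {t h : ℕ} {U : Fin t → Submodule F V}

/-- The `U i` span V, so some u in some `U i` lies outside W. Adjoining it raises dim W by one and
the sum by at least one, so the bound descends from dimension h. -/
lemma IsHDesign.sum_finrank_inf_le [FiniteDimensional F K] [Module.Finite K V]
    (hU : IsHDesign F K h U) (hV : h + 1 ≤ finrank K V) (W : Submodule K V)
    (hW : finrank K W ≤ h) :
    ∑ i, finrank F ↥(U i ⊓ W.restrictScalars F) ≤ finrank K W := by
  have : Module.Finite F V := Module.Finite.trans K V
  obtain ⟨e, he⟩ : ∃ e, finrank K W + e = h := ⟨h - finrank K W, by omega⟩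
  induction e generalizing W with
  | zero =>
    rw [add_zero] at he
    exact (hU.2 W he).trans he.ge
  | succ e ih =>
    obtain ⟨i, u, huU, huW⟩ : ∃ i, ∃ u ∈ U i, u ∉ W := by
      by_contra! hcon
      have hle : Submodule.span K (⋃ i, (U i : Set V)) ≤ W :=
        Submodule.span_le.2 (Set.iUnion_subset fun i u hu => hcon i u hu)
      rw [hU.1, top_le_iff] at hle
      rw [hle, finrank_top] at he
      omega
    have hfin : finrank K ↥(W ⊔ Submodule.span K {u}) = finrank K W + 1 :=
      Submodule.finrank_sup_span_singleton huW
    have h1 := ih (W ⊔ Submodule.span K {u}) (by omega) (by omega)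
    have h2 : ∑ i, finrank F ↥(U i ⊓ W.restrictScalars F) <
        ∑ i, finrank F ↥(U i ⊓ (W ⊔ Submodule.span K {u}).restrictScalars F) := by
      have hmono : ∀ i, U i ⊓ W.restrictScalars F ≤
          U i ⊓ (W ⊔ Submodule.span K {u}).restrictScalars F := fun i =>
        inf_le_inf_left _ fun x hx => (le_sup_left : W ≤ W ⊔ Submodule.span K {u}) hx
      refine Finset.sum_lt_sum (fun i _ => Submodule.finrank_mono (hmono i))
        ⟨i, Finset.mem_univ i, Submodule.finrank_lt_finrank_of_lt
          (lt_of_le_of_ne (hmono i) fun heq => huW ?_)⟩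
      have hu : u ∈ U i ⊓ (W ⊔ Submodule.span K {u}).restrictScalars F :=
        ⟨huU, (le_sup_right : _ ≤ W ⊔ Submodule.span K {u})
          (Submodule.mem_span_singleton_self u)⟩
      rw [← heq] at hu
      exact hu.2
    omega

/-- A dependence would give a K-span W of dimension at most h, smaller than ∑ dim A i, although A i
≤ U i ⊓ W. -/
lemma IsHDesign.linearIndependent_finBasis [FiniteDimensional F K] [Module.Finite K V]
    [Module.Finite F V]
    (hU : IsHDesign F K h U) (hV : h + 1 ≤ finrank K V) (A : Fin t → Submodule F V)
    (hA : ∀ i, A i ≤ U i) (hs : ∑ i, finrank F (A i) ≤ h + 1) :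
    LinearIndependent K
      (fun x : (Σ i, Fin (finrank F (A i))) => (finBasis F (A x.1) x.2 : V)) := by
  rw [linearIndependent_iff_card_le_finrank_span]
  by_contra! hlt
  rw [Fintype.card_sigma] at hlt
  simp only [Fintype.card_fin] at hlt
  set W := Submodule.span K
    (Set.range fun x : (Σ i, Fin (finrank F (A i))) => (finBasis F (A x.1) x.2 : V)) with hW
  have hlt' : finrank K W < ∑ i, finrank F (A i) := hlt
  have h1 := hU.sum_finrank_inf_le hV W (by omega)
  have h2 : ∀ i, A i ≤ U i ⊓ W.restrictScalars F := by
    refine fun i => le_inf (hA i) fun x hx => ?_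
    have hx' := congrArg Subtype.val ((finBasis F (A i)).sum_repr ⟨x, hx⟩)
    rw [← show _ = x from hx', AddSubmonoidClass.coe_finsetSum]
    refine Submodule.sum_mem _ fun p _ => ?_
    exact Submodule.smul_mem _ _ (Submodule.subset_span ⟨⟨i, p⟩, rfl⟩)
  have h3 := Finset.sum_le_sum fun i (_ : i ∈ Finset.univ) => Submodule.finrank_mono (h2 i)
  omega

/-- Injectivity of ⨁ C i ⊗ U i → V. Expanding the u's in F-bases of their spans gives a K-relation
with coefficients in the C i; K-independence kills these, then F-independence of the bases of the C
i kills the coordinates. -/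
lemma IsHDesign.eq_zero_of_sum_smul_eq_zero [FiniteDimensional F K] [Module.Finite K V]
    [Module.Finite F V]
    (hU : IsHDesign F K h U) (hV : h + 1 ≤ finrank K V) (C : Fin t → Submodule F K)
    (hC : ∑ i, finrank F (C i) ≤ h + 1)
    (u : ∀ x : (Σ i, Fin (finrank F (C i))), U x.1)
    (hu : ∑ x, (finBasis F (C x.1) x.2 : K) • (u x : V) = 0) : u = 0 := by
  -- Only the occurring vectors are spanned, so dim A i ≤ dim C i and the bound on C suffices
  -- however large the `U i` are.
  let A : Fin t → Submodule F V := fun i => Submodule.span F (Set.range fun a => (u ⟨i, a⟩ : V))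
  have hA : ∀ i, A i ≤ U i := fun i => by
    rw [Submodule.span_le]
    rintro _ ⟨a, rfl⟩
    exact (u ⟨i, a⟩).2
  have hdim : ∀ i, finrank F (A i) ≤ finrank F (C i) := fun i =>
    (finrank_range_le_card _).trans (Fintype.card_fin _).le
  have hli := hU.linearIndependent_finBasis hV A hA
    ((Finset.sum_le_sum fun i _ => hdim i).trans hC)
  let w : ∀ i, Fin (finrank F (C i)) → A i := fun i a => ⟨u ⟨i, a⟩, Submodule.subset_span ⟨a, rfl⟩⟩
  have hw : ∀ i a, ∑ p, (finBasis F (A i)).repr (w i a) p • (finBasis F (A i) p : V) =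
      u ⟨i, a⟩ := by
    intro i a
    have := congrArg Subtype.val ((finBasis F (A i)).sum_repr (w i a))
    rwa [AddSubmonoidClass.coe_finsetSum] at this
  have hexch : ∀ i, ∑ p, (∑ a, (finBasis F (A i)).repr (w i a) p • (finBasis F (C i) a : K)) •
      (finBasis F (A i) p : V) = ∑ a, (finBasis F (C i) a : K) • (u ⟨i, a⟩ : V) := by
    intro i
    simp_rw [Finset.sum_smul]
    rw [Finset.sum_comm]
    refine Finset.sum_congr rfl fun a _ => ?_
    rw [← hw, Finset.smul_sum]
    refine Finset.sum_congr rfl fun p _ => ?_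
    rw [smul_assoc, smul_comm]
  have hcoef := Fintype.linearIndependent_iff.1 hli
    (fun y => ∑ a, (finBasis F (A y.1)).repr (w y.1 a) y.2 • (finBasis F (C y.1) a : K)) (by
      rw [← hu, Fintype.sum_sigma, Fintype.sum_sigma]
      exact Finset.sum_congr rfl fun i _ => hexch i)
  funext ⟨i, a⟩
  have hzero : ∀ p, (finBasis F (A i)).repr (w i a) p = 0 := fun p =>
    Fintype.linearIndependent_iff.1
      ((finBasis F (C i)).linearIndependent.map' (C i).subtype (Submodule.ker_subtype _))
      (fun a => (finBasis F (A i)).repr (w i a) p) (hcoef ⟨i, p⟩) a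
  refine Subtype.ext ?_
  rw [← hw]
  simp [hzero]

end Independence

/-! ### Trace duality and counting functionals with bounded images. -/

section Duality

variable {F K V : Type*} [Field F] [Field K] [Algebra F K] [AddCommGroup V] [Module K V]
  [Module F V] [IsScalarTower F K V] {t h : ℕ} {U : Fin t → Submodule F V}

lemma trace_comp_injective [Finite F] [FiniteDimensional F K] :
    Function.Injective fun φ : Dual K V =>
      (Algebra.trace F K ∘ₗ φ.restrictScalars F : Dual F V) := by
  intro φ ψ hφψ
  ext v
  rw [← sub_eq_zero]
  refine (traceForm_nondegenerate F K).1 _ fun c => ?_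
  have := LinearMap.congr_fun hφψ (c • v)
  simp only [LinearMap.comp_apply, LinearMap.restrictScalars_apply, map_smul,
    smul_eq_mul] at this
  rw [Algebra.traceForm_apply, mul_comm, mul_sub, map_sub, this, sub_self]

/-- Injectivity is nondegeneracy of the trace form; both duals have q^(dim_F V) elements. -/
lemma trace_comp_bijective [Finite F] [FiniteDimensional F K] [Module.Finite K V] :
    Function.Bijective fun φ : Dual K V =>
      (Algebra.trace F K ∘ₗ φ.restrictScalars F : Dual F V) := by
  have : Module.Finite F V := Module.Finite.trans K V
  have : Finite K := Module.finite_of_finite F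
  have : Finite (Dual F V) := Module.finite_of_finite F
  refine (Nat.bijective_iff_injective_and_card _).2 ⟨trace_comp_injective, ?_⟩
  rw [Module.natCard_eq_pow_finrank (K := K), Module.natCard_eq_pow_finrank (K := F) (V := K),
    Module.natCard_eq_pow_finrank (K := F) (V := Dual F V), Subspace.dual_finrank_eq,
    Subspace.dual_finrank_eq, ← pow_mul, Module.finrank_mul_finrank]

/-- The linear combinations of vectors of the `U i` with coefficients in a basis of `C i`. -/
noncomputable def smulBasisMap [Module.Finite F K] (C : Fin t → Submodule F K) (U : Fin t → Submodule F V) :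
    (∀ x : (Σ i, Fin (finrank F (C i))), U x.1) →ₗ[F] V where
  toFun u := ∑ x, (finBasis F (C x.1) x.2 : K) • (u x : V)
  map_add' u v := by simp [smul_add, Finset.sum_add_distrib]
  map_smul' c u := by simp [Finset.smul_sum, smul_comm c]

lemma smul_mem_range_smulBasisMap [Module.Finite F K] (C : Fin t → Submodule F K) {i : Fin t}
    {c : K} (hc : c ∈ C i) {u : V} (hu : u ∈ U i) :
    c • u ∈ LinearMap.range (smulBasisMap C U) := by
  classical
  have hc' := congrArg Subtype.val ((finBasis F (C i)).sum_repr ⟨c, hc⟩)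
  rw [← show _ = c from hc', AddSubmonoidClass.coe_finsetSum, Finset.sum_smul]
  refine Submodule.sum_mem _ fun a _ => ?_
  rw [Submodule.coe_smul, smul_assoc]
  refine Submodule.smul_mem _ _
    ⟨Pi.single (M := fun x : (Σ i, Fin (finrank F (C i))) => U x.1) ⟨i, a⟩ ⟨u, hu⟩, ?_⟩
  change ∑ x, _ = _
  rw [Finset.sum_eq_single (⟨i, a⟩ : Σ i, Fin (finrank F (C i)))]
  · rw [Pi.single_eq_same]
  · intro x _ hx
    rw [Pi.single_eq_of_ne hx]
    simp
  · simp

/-- By K-linearity Tr(c φ(u)) = Tr(φ(c u)); the converse uses that B i is its own double orthogonal.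
-/
lemma map_le_iff_trace_comp_mem [Finite F] [FiniteDimensional F K] (B : Fin t → Submodule F K)
    (φ : Dual K V) :
    (∀ i, (U i).map (φ.restrictScalars F) ≤ B i) ↔
      (Algebra.trace F K ∘ₗ φ.restrictScalars F) ∈
        (LinearMap.range (smulBasisMap
          (fun i => (Algebra.traceForm F K).orthogonal (B i)) U)).dualAnnihilator := by
  have hrefl : (Algebra.traceForm F K).IsRefl := (Algebra.traceForm_isSymm F).isRefl
  rw [Submodule.mem_dualAnnihilator]
  constructor
  · rintro hφ _ ⟨u, rfl⟩
    change (Algebra.trace F K) (φ (∑ x, _)) = 0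
    rw [map_sum, map_sum]
    refine Finset.sum_eq_zero fun x _ => ?_
    have h1 := hφ x.1 (Submodule.mem_map_of_mem (u x).2)
    have h2 := (finBasis F ((Algebra.traceForm F K).orthogonal (B x.1)) x.2).2 _ h1
    rw [map_smul, smul_eq_mul, mul_comm]
    exact h2
  · rintro hφ i _ ⟨u, hu, rfl⟩
    rw [← LinearMap.BilinForm.orthogonal_orthogonal (traceForm_nondegenerate F K) hrefl (B i)]
    intro c hc
    have h1 := hφ _ (smul_mem_range_smulBasisMap
      (fun i => (Algebra.traceForm F K).orthogonal (B i)) hc hu)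
    rw [LinearMap.comp_apply, LinearMap.restrictScalars_apply, map_smul, smul_eq_mul] at h1
    exact h1

theorem IsHDesign.natCard_map_le [Finite F] [FiniteDimensional F K] [Module.Finite K V]
    (hU : IsHDesign F K h U) (hV : h + 1 ≤ finrank K V) {n : ℕ} (hn : ∀ i, finrank F (U i) = n)
    (hnV : n * (h + 1) = finrank F V) (B : Fin t → Submodule F K)
    (hB : ∑ i, (finrank F K - finrank F (B i)) ≤ h + 1) :
    Nat.card {φ : Dual K V // ∀ i, (U i).map (φ.restrictScalars F) ≤ B i} =
      Nat.card F ^ (n * (h + 1 - ∑ i, (finrank F K - finrank F (B i)))) := by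
  have : Module.Finite F V := Module.Finite.trans K V
  set C : Fin t → Submodule F K := fun i => (Algebra.traceForm F K).orthogonal (B i) with hCdef
  have hC : ∑ i, finrank F (C i) = ∑ i, (finrank F K - finrank F (B i)) :=
    Finset.sum_congr rfl fun i _ =>
      LinearMap.BilinForm.finrank_orthogonal (traceForm_nondegenerate F K) _
  have hinj : Function.Injective (smulBasisMap C U) := by
    rw [← LinearMap.ker_eq_bot, LinearMap.ker_eq_bot']
    exact fun u hu => hU.eq_zero_of_sum_smul_eq_zero hV C (hC.le.trans hB) u hu
  have hrange : finrank F (LinearMap.range (smulBasisMap C U)) = n * ∑ i, finrank F (C i) := by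
    rw [LinearMap.finrank_range_of_inj hinj, Module.finrank_pi_fintype]
    simp [hn, mul_comm]
  have hann := Subspace.finrank_add_finrank_dualAnnihilator_eq
    (LinearMap.range (smulBasisMap C U))
  have e : {φ : Dual K V // ∀ i, (U i).map (φ.restrictScalars F) ≤ B i} ≃
      (LinearMap.range (smulBasisMap C U)).dualAnnihilator :=
    (Equiv.ofBijective _ (trace_comp_bijective (F := F) (K := K) (V := V))).subtypeEquiv
      (map_le_iff_trace_comp_mem B)
  rw [Nat.card_congr e, Module.natCard_eq_pow_finrank (K := F), ← hC, Nat.mul_sub]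
  congr 1
  omega

end Duality

/-! ### Functionals with prescribed images. -/

section Weights

variable {F K V : Type*} [Field F] [Field K] [Algebra F K] [AddCommGroup V] [Module K V]
  [Module F V] [IsScalarTower F K V] {t h n : ℕ} {U : Fin t → Submodule F V}

lemma sum_finrank_le (B : Fin t → Submodule F K) [FiniteDimensional F K] :
    ∑ i, finrank F (B i) ≤ t * finrank F K := by
  simpa using Finset.sum_le_sum fun i (_ : i ∈ Finset.univ) => (B i).finrank_le

lemma sum_finrank_update_add (B : Fin t → Submodule F K) (i : Fin t) (W : Submodule F K) :
    ∑ k, finrank F (Function.update B i W k) + finrank F (B i) =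
      ∑ k, finrank F (B k) + finrank F W := by
  have hfun : (fun k => finrank F (Function.update B i W k)) =
      Function.update (fun k => finrank F (B k)) i (finrank F W) := by
    funext k
    exact Function.apply_update (fun _ (W : Submodule F K) => finrank F W) B i W k
  have hsplit := Finset.add_sum_erase Finset.univ (fun k => finrank F (B k)) (Finset.mem_univ i)
  rw [hfun, Finset.sum_update_of_mem (Finset.mem_univ i), ← Finset.erase_eq]
  omega

lemma exists_tuple_ge_finrank_eq [FiniteDimensional F K] (B : Fin t → Submodule F K) (r : ℕ)
    (hB : ∑ i, finrank F (B i) ≤ r) (hr : r ≤ t * finrank F K) :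
    ∃ B' : Fin t → Submodule F K, B ≤ B' ∧ ∑ i, finrank F (B' i) = r := by
  obtain ⟨e, rfl⟩ := Nat.exists_eq_add_of_le hB
  clear hB
  induction e with
  | zero => exact ⟨B, le_rfl, rfl⟩
  | succ e ih =>
    obtain ⟨B', hBB', hB'⟩ := ih (by omega)
    obtain ⟨i, hi⟩ : ∃ i, B' i ≠ ⊤ := by
      by_contra! hcon
      have : ∑ i, finrank F (B' i) = t * finrank F K := by
        rw [show B' = fun _ => ⊤ from funext hcon]
        simp
      omega
    obtain ⟨x, -, hx⟩ := SetLike.exists_of_lt (lt_top_iff_ne_top.2 hi)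
    refine ⟨Function.update B' i (B' i ⊔ Submodule.span F {x}), hBB'.trans ?_, ?_⟩
    · rw [le_update_iff]
      exact ⟨le_sup_left, fun _ _ => le_rfl⟩
    · have h1 := sum_finrank_update_add B' i (B' i ⊔ Submodule.span F {x})
      have h2 : finrank F ↥(B' i ⊔ Submodule.span F {x}) = finrank F (B' i) + 1 :=
        Submodule.finrank_sup_span_singleton hx
      omega

lemma sum_finrank_sub (B : Fin t → Submodule F K) [FiniteDimensional F K] :
    ∑ i, (finrank F K - finrank F (B i)) = t * finrank F K - ∑ i, finrank F (B i) := by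
  have : ∑ i, (finrank F K - finrank F (B i)) + ∑ i, finrank F (B i) = t * finrank F K := by
    rw [← Finset.sum_add_distrib, Finset.sum_congr rfl
      (fun i _ => Nat.sub_add_cancel (B i).finrank_le)]
    simp
  omega

lemma IsHDesign.eq_zero_of_forall_map_le_bot (hU : IsHDesign F K h U) (φ : Dual K V)
    (hφ : ∀ i, (U i).map (φ.restrictScalars F) ≤ ⊥) : φ = 0 := by
  have hle : Submodule.span K (⋃ i, (U i : Set V)) ≤ LinearMap.ker φ :=
    Submodule.span_le.2 (Set.iUnion_subset fun i u hu =>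
      (Submodule.mem_bot F).1 (hφ i (Submodule.mem_map_of_mem hu)))
  rw [hU.1, top_le_iff] at hle
  exact LinearMap.ker_eq_top.1 hle

variable [Finite F] [FiniteDimensional F K] [Module.Finite K V]

/-- Otherwise the count for B = ⊥ would exceed 1, while spanning leaves only φ = 0. Hence d = tm - h
is a genuine positive difference. -/
lemma IsHDesign.succ_le_mul_finrank (hU : IsHDesign F K h U) (hV : h + 1 ≤ finrank K V)
    (hn : ∀ i, finrank F (U i) = n) (hnV : n * (h + 1) = finrank F V) :
    h + 1 ≤ t * finrank F K := by
  by_contra! hlt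
  have hbot : ∑ i : Fin t, (finrank F K - finrank F ((⊥ : Fin t → Submodule F K) i)) =
      t * finrank F K := by simp
  have hN := hU.natCard_map_le hV hn hnV ⊥ (hbot.le.trans hlt.le)
  have : Subsingleton {φ : Dual K V // ∀ i, (U i).map (φ.restrictScalars F) ≤
      (⊥ : Fin t → Submodule F K) i} :=
    ⟨fun φ ψ => Subtype.ext ((hU.eq_zero_of_forall_map_le_bot φ.1 φ.2).trans
      (hU.eq_zero_of_forall_map_le_bot ψ.1 ψ.2).symm)⟩
  have hle := Finite.card_le_one_iff_subsingleton.2 this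
  have hpos : 0 < n := by
    have h1 : 0 < finrank F V := by
      rw [← Module.finrank_mul_finrank F K V]
      exact Nat.mul_pos Module.finrank_pos (by omega)
    rw [← hnV] at h1
    exact Nat.pos_of_mul_pos_right h1
  have hgt : 1 < Nat.card F ^ (n * (h + 1 - t * finrank F K)) :=
    Nat.one_lt_pow (Nat.mul_pos hpos (by omega)).ne' Finite.one_lt_card
  rw [hbot] at hN
  omega

/-- The number of functionals mapping each `U i` into `B i`. -/
theorem IsHDesign.natCard_map_le_eq_pow (hU : IsHDesign F K h U) (hV : h + 1 ≤ finrank K V)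
    (hn : ∀ i, finrank F (U i) = n) (hnV : n * (h + 1) = finrank F V)
    (B : Fin t → Submodule F K) :
    Nat.card {φ : Dual K V // ∀ i, (U i).map (φ.restrictScalars F) ≤ B i} =
      Nat.card F ^ (n * (∑ i, finrank F (B i) + 1 - (t * finrank F K - h))) := by
  have hd := hU.succ_le_mul_finrank hV hn hnV
  have key : ∀ B : Fin t → Submodule F K,
      t * finrank F K - (h + 1) ≤ ∑ i, finrank F (B i) →
      Nat.card {φ : Dual K V // ∀ i, (U i).map (φ.restrictScalars F) ≤ B i} =
        Nat.card F ^ (n * (∑ i, finrank F (B i) + 1 - (t * finrank F K - h))) := by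
    intro B hB
    have hs := sum_finrank_sub B
    have hs' := sum_finrank_le B
    rw [hU.natCard_map_le hV hn hnV B (by omega), hs]
    congr 2
    omega
  -- Below total dimension d - 1 the duality count is unavailable. Enlarging B to total dimension
  -- exactly d - 1 gives count 1, so only φ = 0 remains, matching the truncated exponent 0.
  rcases le_or_gt (t * finrank F K - (h + 1)) (∑ i, finrank F (B i)) with hB | hB
  · exact key B hB
  · have : Finite K := Module.finite_of_finite F
    have : Finite (Dual K V) := Module.finite_of_finite K
    obtain ⟨B', hBB', hB'⟩ := exists_tuple_ge_finrank_eq B _ hB.le (Nat.sub_le _ _)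
    have h1 := key B' hB'.ge
    rw [hB', show t * finrank F K - (h + 1) + 1 - (t * finrank F K - h) = 0 by omega,
      mul_zero, pow_zero] at h1
    rw [show ∑ i, finrank F (B i) + 1 - (t * finrank F K - h) = 0 by omega, mul_zero, pow_zero]
    refine le_antisymm ?_ (Nat.card_pos_iff.2 ⟨⟨0, fun i => ?_⟩, inferInstance⟩)
    · rw [← h1]
      exact Nat.card_le_card_of_injective
        (fun φ => ⟨φ.1, fun i => (φ.2 i).trans (hBB' i)⟩)
        fun φ ψ e => by
          have := congrArg Subtype.val e
          exact Subtype.ext this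
    · rintro _ ⟨u, -, rfl⟩
      exact (B i).zero_mem

open Classical in
lemma sum_natCard_map_eq [Fintype (Submodule F K)] (P : (Fin t → Submodule F K) → Prop) :
    ∑ D : Fin t → Submodule F K with P D,
      Nat.card {φ : Dual K V // (fun i => (U i).map (φ.restrictScalars F)) = D} =
    Nat.card {φ : Dual K V // P fun i => (U i).map (φ.restrictScalars F)} := by
  have : Finite K := Module.finite_of_finite F
  have : Finite (Dual K V) := Module.finite_of_finite K
  have := Fintype.ofFinite (Dual K V)
  rw [Nat.card_eq_fintype_card, Fintype.card_subtype,
    Finset.card_eq_sum_card_fiberwise (t := Finset.univ.filter P)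
      (f := fun φ : Dual K V => fun i => (U i).map (φ.restrictScalars F))
      (fun φ hφ => by simpa using hφ)]
  refine Finset.sum_congr rfl fun D hD => ?_
  rw [Nat.card_eq_fintype_card, Fintype.card_subtype, Finset.filter_filter]
  congr 1
  ext φ
  simp only [Finset.mem_filter, Finset.mem_univ, true_and]
  refine ⟨fun e => ⟨?_, e⟩, fun e => e.2⟩
  rw [e]
  exact (Finset.mem_filter.1 hD).2

/-- The number of functionals with prescribed images of the `U i`. -/
theorem IsHDesign.natCard_map_eq (hU : IsHDesign F K h U) (hV : h + 1 ≤ finrank K V)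
    (hn : ∀ i, finrank F (U i) = n) (hnV : n * (h + 1) = finrank F V)
    (B : Fin t → Submodule F K) {r : ℕ} (hr : ∑ i, finrank F (B i) = r)
    (hdr : t * finrank F K - h ≤ r) :
    (Nat.card {φ : Dual K V // (fun i => (U i).map (φ.restrictScalars F)) = B} : ℚ) =
      ∑ l ∈ Finset.Icc (t * finrank F K - h) r,
        ((Nat.card F : ℚ) ^ (n * (l - (t * finrank F K - h) + 1)) - 1) *
          latticeCoeff (Nat.card F) l (fun i => finrank F (B i)) := by
  classical
  have : Finite K := Module.finite_of_finite F
  have := Fintype.ofFinite (Submodule F K)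
  have hd := hU.succ_le_mul_finrank hV hn hnV
  set d := t * finrank F K - h with hdd
  rw [← moebius_inversion_tuple
    (fun B => (Nat.card {φ : Dual K V // (fun i => (U i).map (φ.restrictScalars F)) = B} : ℚ)) B]
  have hN : ∀ C : Fin t → Submodule F K, ∑ D : Fin t → Submodule F K with D ≤ C,
      (Nat.card {φ : Dual K V // (fun i => (U i).map (φ.restrictScalars F)) = D} : ℚ) =
      (fun l => (Nat.card F : ℚ) ^ (n * (l + 1 - d))) (∑ i, finrank F (C i)) := by
    intro C
    rw [← Nat.cast_sum, sum_natCard_map_eq (fun D => D ≤ C)]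
    have := hU.natCard_map_le_eq_pow hV hn hnV C
    simp only [Pi.le_def, this, Nat.cast_pow]
    rfl
  simp_rw [hN]
  -- Subtracting the vanishing sum of `latticeCoeff` replaces each power by power minus 1. This
  -- removes the terms l < d, where the truncated exponent is 0; it needs r ≠ 0, which holds as r ≥
  -- d ≥ 1.
  rw [sum_moebiusCoeff_mul_eq_sum_latticeCoeff (fun l => (Nat.card F : ℚ) ^ (n * (l + 1 - d))) B,
    ← sub_zero (∑ l ∈ _, _), ← sum_latticeCoeff_eq_zero (q := Nat.card F)
      (u := fun i => finrank F (B i)) Finite.one_lt_card (by omega),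
    ← Finset.sum_sub_distrib, hr]
  symm
  refine Finset.sum_subset_zero_on_sdiff ?_ ?_ ?_
  · intro l hl
    rw [Finset.mem_Icc] at hl
    rw [Finset.mem_range]
    omega
  · intro l hl
    rw [Finset.mem_sdiff, Finset.mem_range, Finset.mem_Icc] at hl
    rw [show l + 1 - d = 0 by omega]
    simp
  · intro l hl
    rw [Finset.mem_Icc] at hl
    rw [show l + 1 - d = l - d + 1 by omega]
    ring

/-- If B were missed, each φ into B would have some φ(U i) in a hyperplane of B i. Each such
shrinking divides the count by q^n, and there are at most t(q^m - 1)/(q - 1) ≤ q^m - 1 < q^n of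
them. -/
theorem IsHDesign.exists_map_eq (hU : IsHDesign F K h U) (hV : h + 1 ≤ finrank K V)
    (hn : ∀ i, finrank F (U i) = n) (hnV : n * (h + 1) = finrank F V)
    (hKn : finrank F K ≤ n) (ht : t ≤ Nat.card F - 1)
    (B : Fin t → Submodule F K) (hB : t * finrank F K - h ≤ ∑ i, finrank F (B i)) :
    ∃ φ : Dual K V, (fun i => (U i).map (φ.restrictScalars F)) = B := by
  classical
  by_contra! hcon
  have : Finite K := Module.finite_of_finite F
  have : Finite V := Module.finite_of_finite K
  have : Finite (Dual K V) := Module.finite_of_finite K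
  set d := t * finrank F K - h with hdd
  set q := Nat.card F with hq
  have hq1 : 1 < q := Finite.one_lt_card
  -- The conjunct `True` matches the form of `natCard_nonzero_dual_eq`.
  let X := Σ i, {H : Submodule F (B i) // finrank F H + 1 = finrank F (B i) ∧ True}
  let B' : X → Fin t → Submodule F K := fun x =>
    Function.update B x.1 (x.2.1.map (B x.1).subtype)
  have hsub : ∀ φ : {φ : Dual K V // ∀ i, (U i).map (φ.restrictScalars F) ≤ B i},
      ∃ x : X, ∀ i, (U i).map (φ.1.restrictScalars F) ≤ B' x i := by
    rintro ⟨φ, hφ⟩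
    obtain ⟨i, hi⟩ := Function.ne_iff.1 (hcon φ)
    have hlt : ((U i).map (φ.restrictScalars F)).comap (B i).subtype < ⊤ := by
      rw [lt_top_iff_ne_top, Ne, Submodule.comap_subtype_eq_top]
      exact fun hle => hi (le_antisymm (hφ i) hle)
    obtain ⟨f, hf0, hf⟩ := Submodule.exists_le_ker_of_lt_top _ hlt
    refine ⟨⟨i, LinearMap.ker f, Dual.finrank_ker_add_one_of_ne_zero hf0, trivial⟩, ?_⟩
    refine le_update_iff.2 ⟨?_, fun k _ => hφ k⟩
    have := Submodule.map_mono (f := (B i).subtype) hf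
    rwa [Submodule.map_comap_subtype, inf_eq_right.2 (hφ i)] at this
  choose x hx using hsub
  have hcard := Nat.card_le_card_of_injective
    (fun φ : {φ : Dual K V // ∀ i, (U i).map (φ.restrictScalars F) ≤ B i} =>
      (⟨x φ, φ.1, hx φ⟩ :
        Σ y : X, {φ : Dual K V // ∀ i, (U i).map (φ.restrictScalars F) ≤ B' y i}))
    (fun φ ψ e => by
      have := congrArg (fun p : (Σ y : X,
        {φ : Dual K V // ∀ i, (U i).map (φ.restrictScalars F) ≤ B' y i}) => p.2.1) e
      exact Subtype.ext this)
  have hB' : ∀ y : X, ∑ i, finrank F (B' y i) + 1 = ∑ i, finrank F (B i) := by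
    rintro ⟨i, H, hH, -⟩
    have h1 := sum_finrank_update_add B i (H.map (B i).subtype)
    rw [Submodule.finrank_map_subtype_eq] at h1
    change ∑ k, finrank F (Function.update B i (H.map (B i).subtype) k) + 1 = _
    omega
  have := Fintype.ofFinite X
  have hX : Nat.card X * (q - 1) ≤ (q - 1) * (q ^ finrank F K - 1) := by
    have hi : ∀ i, Nat.card {H : Submodule F (B i) // finrank F H + 1 = finrank F (B i) ∧ True} *
        (q - 1) ≤ q ^ finrank F K - 1 := by
      intro i
      have : Finite (Dual F (B i)) := Module.finite_of_finite F
      have := Fintype.ofFinite (Dual F (B i))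
      rw [← natCard_nonzero_dual_eq (fun _ => True)]
      simp only [and_true]
      have h0 : Fintype.card {φ : Dual F (B i) // φ ≠ 0} = Fintype.card (Dual F (B i)) - 1 :=
        Set.card_ne_eq 0
      rw [Nat.card_eq_fintype_card, h0, ← Nat.card_eq_fintype_card,
        Module.natCard_eq_pow_finrank (K := F), Subspace.dual_finrank_eq]
      exact Nat.sub_le_sub_right (Nat.pow_le_pow_right (by omega) (B i).finrank_le) 1
    rw [Nat.card_sigma, Finset.sum_mul]
    refine (Finset.sum_le_sum fun i _ => hi i).trans ?_
    rw [Finset.sum_const, Finset.card_univ, Fintype.card_fin, smul_eq_mul]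
    exact Nat.mul_le_mul_right _ ht
  have hfib : ∀ y : X, Nat.card {φ : Dual K V // ∀ i, (U i).map (φ.restrictScalars F) ≤ B' y i} =
      q ^ (n * (∑ i, finrank F (B i) - d)) := fun y => by
    rw [hU.natCard_map_le_eq_pow hV hn hnV (B' y), hB' y]
  rw [Nat.card_sigma, hU.natCard_map_le_eq_pow hV hn hnV B, Finset.sum_congr rfl
    (fun y _ => hfib y), Finset.sum_const, Finset.card_univ, smul_eq_mul,
    ← Nat.card_eq_fintype_card, ← hdd, ← hq,
    show ∑ i, finrank F (B i) + 1 - d = (∑ i, finrank F (B i) - d) + 1 by omega,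
    Nat.mul_succ, pow_add, mul_comm] at hcard
  have h1 : q ^ n ≤ Nat.card X := Nat.le_of_mul_le_mul_right hcard (by positivity)
  have h2 : q ^ finrank F K ≤ q ^ n := Nat.pow_le_pow_right (by omega) hKn
  have h3 : Nat.card X ≤ q ^ finrank F K - 1 := by
    rw [mul_comm] at hX
    exact Nat.le_of_mul_le_mul_left hX (by omega)
  have h4 : 0 < q ^ finrank F K := by positivity
  omega

end Weights

/-! ### Weight distribution and conclusion. -/

section Main

open Classical in
lemma msrdWeight_eq_sum {F K : Type*} [Field F] [Field K] [Algebra F K] [FiniteDimensional F K]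
    [Fintype (Submodule F K)] (m' t d r : ℕ) :
    msrdWeight F (finrank F K) m' t d r =
      ∑ B : Fin t → Submodule F K with ∑ i, finrank F (B i) = r,
        ∑ l ∈ Finset.Icc d r, ((Nat.card F : ℚ) ^ (m' * (l - d + 1)) - 1) *
          latticeCoeff (Nat.card F) l (fun i => finrank F (B i)) := by
  let e : K ≃ₗ[F] (Fin (finrank F K) → F) := (finBasis F K).equivFun
  let E : (Fin t → Submodule F K) ≃ (Fin t → Submodule F (Fin (finrank F K) → F)) :=
    Equiv.piCongrRight fun _ => (Submodule.orderIsoMapComap e).toEquiv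
  have hE : ∀ B i, finrank F (E B i) = finrank F (B i) := fun B i => e.finrank_map_eq (B i)
  rw [msrdWeight, finsum_mem_def, ← finsum_comp_equiv E, finsum_eq_sum_of_fintype,
    Finset.sum_filter]
  refine Finset.sum_congr rfl fun B _ => ?_
  rw [Set.indicator_apply]
  simp only [Set.mem_ofPred_eq, hE]

variable {F K V : Type*} [Field F] [Field K] [Algebra F K] [FiniteDimensional F K]
  [AddCommGroup V] [Module K V] [Module F V] [IsScalarTower F K V] [Module.Finite K V]
  {t h n : ℕ} {U : Fin t → Submodule F V}

lemma sum_finrank_map_add_sum_finrank_inf_ker (hn : ∀ i, finrank F (U i) = n) (φ : Dual K V) :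
    ∑ i, finrank F ((U i).map (φ.restrictScalars F)) +
      ∑ i, finrank F ↥(U i ⊓ (LinearMap.ker φ).restrictScalars F) = t * n := by
  have : Module.Finite F V := Module.Finite.trans K V
  rw [← Finset.sum_add_distrib, Finset.sum_congr rfl (g := fun _ => n)]
  · simp
  · intro i _
    have h1 := LinearMap.finrank_range_add_finrank_ker ((φ.restrictScalars F).domRestrict (U i))
    rw [LinearMap.range_domRestrict, LinearMap.ker_domRestrict, hn,
      ← Submodule.finrank_map_subtype_eq, Submodule.map_comap_subtype] at h1
    exact h1

variable [Finite F]

/-- The number of functionals of weight `r`. -/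
theorem IsHDesign.natCard_weight_eq (hU : IsHDesign F K h U) (hV : h + 1 ≤ finrank K V)
    (hn : ∀ i, finrank F (U i) = n) (hnV : n * (h + 1) = finrank F V) {r : ℕ}
    (hdr : t * finrank F K - h ≤ r) :
    (Nat.card {φ : Dual K V // ∑ i, finrank F ((U i).map (φ.restrictScalars F)) = r} : ℚ) =
      msrdWeight F (finrank F K) n t (t * finrank F K - h) r := by
  classical
  have : Finite K := Module.finite_of_finite F
  have := Fintype.ofFinite (Submodule F K)
  rw [msrdWeight_eq_sum, ← sum_natCard_map_eq (fun D => ∑ i, finrank F (D i) = r), Nat.cast_sum]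
  refine Finset.sum_congr (by congr) fun B hB => ?_
  exact hU.natCard_map_eq hV hn hnV B (Finset.mem_filter.1 hB).2 hdr

end Main
theorem mainTheorem8 (F K : Type*) [Field F] [Finite F] [Field K] [Finite K] [Algebra F K]
    (m n k h t : ℕ) (hm : Module.finrank F K = m)
    (hhk : h + 1 ≤ k) (hn : n * (h + 1) = m * k)
    (U : Fin t → Submodule F (Fin k → K))
    (hU : IsHDesign F K h U)
    (hdim : ∀ i, Module.finrank F (U i) = n)
    (j : ℕ) (hj : j ≤ h) :
    (Nat.card {H : Submodule K (Fin k → K) // Module.finrank K H + 1 = k ∧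
        ∑ i, Module.finrank F ↥(U i ⊓ H.restrictScalars F) = t * (n - m) + j} : ℚ) =
      msrdWeight F m n t (t * m - h) (t * m - j) / ((Nat.card F : ℚ) ^ m - 1) ∧
    (t ≤ Nat.card F - 1 →
      0 < msrdWeight F m n t (t * m - h) (t * m - j) / ((Nat.card F : ℚ) ^ m - 1)) := by
  subst hm
  have hKfin : FiniteDimensional F K := Module.Finite.of_finite
  have hV : h + 1 ≤ finrank K (Fin k → K) := by simpa using hhk
  have hnV : n * (h + 1) = finrank F (Fin k → K) := by
    rw [hn, ← Module.finrank_mul_finrank F K (Fin k → K), Module.finrank_fin_fun]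
  have hd := hU.succ_le_mul_finrank hV hdim hnV
  have hmn : finrank F K ≤ n := by
    refine Nat.le_of_mul_le_mul_right (c := h + 1) ?_ (Nat.succ_pos h)
    rw [hn]
    exact Nat.mul_le_mul_left _ hhk
  have hW := hU.natCard_weight_eq hV hdim hnV (r := t * finrank F K - j) (by omega)
  have hq : (1 : ℚ) < (Nat.card F : ℚ) ^ finrank F K :=
    one_lt_pow₀ (by exact_mod_cast Finite.one_lt_card) Module.finrank_pos.ne'
  have hq0 : (Nat.card F : ℚ) ^ finrank F K - 1 ≠ 0 := by linarith
  rw [← hW]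
  -- Rank-nullity gives tn - (tm - j) = t(n - m) + j; φ ≠ 0 is automatic because j ≤ h < tm makes
  -- the weight positive.
  have hweight : ∀ φ : Dual K (Fin k → K),
      (∑ i, finrank F ((U i).map (φ.restrictScalars F)) = t * finrank F K - j) ↔
      φ ≠ 0 ∧ ∑ i, finrank F ↥(U i ⊓ (LinearMap.ker φ).restrictScalars F) =
        t * (n - finrank F K) + j := by
    intro φ
    have h1 := sum_finrank_map_add_sum_finrank_inf_ker hdim φ
    have h2 : t * (n - finrank F K) + t * finrank F K = t * n := by
      rw [← mul_add, Nat.sub_add_cancel hmn]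
    constructor
    · intro h3
      refine ⟨?_, by omega⟩
      rintro rfl
      have h0 : ∀ i, finrank F ((U i).map ((0 : Dual K (Fin k → K)).restrictScalars F)) = 0 :=
        fun i => by rw [LinearMap.restrictScalars_zero, Submodule.map_zero, finrank_bot]
      rw [Finset.sum_eq_zero fun i _ => h0 i] at h3
      omega
    · rintro ⟨-, h3⟩
      omega
  have hcount := natCard_nonzero_dual_eq (K := K) (V := Fin k → K) fun H =>
    ∑ i, finrank F ↥(U i ⊓ H.restrictScalars F) = t * (n - finrank F K) + j
  simp only [← hweight, Module.finrank_fin_fun] at hcount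
  have hcast : ((Nat.card K - 1 : ℕ) : ℚ) = (Nat.card F : ℚ) ^ finrank F K - 1 := by
    rw [Nat.cast_sub Finite.card_pos, Module.natCard_eq_pow_finrank (K := F) (V := K)]
    push_cast
    rfl
  constructor
  · rw [hcount, Nat.cast_mul, hcast, mul_div_assoc, div_self hq0, mul_one]
  · intro ht
    refine div_pos ?_ (by linarith)
    have : Finite (Dual K (Fin k → K)) := Module.finite_of_finite K
    -- Any B of total dimension tm - j ≥ d will do: realising it as the images of some φ makes the
    -- count nonzero.
    obtain ⟨B, -, hB⟩ := exists_tuple_ge_finrank_eq (⊥ : Fin t → Submodule F K)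
      (t * finrank F K - j) (by simp) (Nat.sub_le _ _)
    obtain ⟨φ, hφ⟩ := hU.exists_map_eq hV hdim hnV hmn ht B (by omega)
    rw [Nat.cast_pos, Nat.card_pos_iff]
    refine ⟨⟨φ, ?_⟩, inferInstance⟩
    rw [← hB, ← hφ]
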